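/- Let $k\ge 1$ and let $\{X_t\}_{t\in\mathbb Z}$ be a real-valued, mean-zero, $(k+1)$-th order stationary time series (that is, $E|X_t|^{k+1}<\infty$ and all joint moments of order at most $k+1$ are invariant under time shifts). Write $\gamma(h_1,\dots,h_n)=\mathrm{Cum}(X_t,X_{t+h_1},\dots,X_{t+h_n})$ for its autocumulants, $1\le n\le k$, and suppose that for every $2\le r\le k+1$ $$\sum_{v\in\mathbb Z^{r-1}}|v_j\,\gamma(v_1,\dots,v_{r-1})|<\infty,\qquad j=1,\dots,r-1 .$$ Let $f_k(\lambda)=\sum_{h\in\mathbb Z^k}\gamma(h)e^{-\iota h'\lambda}$ be the $k$-th order polyspectrum. Let $g:[-\pi,\pi]^k\to\mathbb C$ be bounded, continuous outside a set of Lebesgue measure zero, with $\int|g|<\infty$ and $g(\lambda)=\overline{g(-\lambda)}$ for all $\lambda$, and put $M_g(f_k)=\int_{[-\pi,\pi]^k}f_k(\lambda)g(\lambda)\,d\lambda$. For a sample $X_1,\dots,X_T$ let $d(\lambda)=\sum_{t=1}^T X_te^{-\iota\lambda t}$ and $\hat f_k(\lambda)=T^{-1}d(\lambda_1)\cdots d(\lambda_k)\,d(-\lambda_1-\cdots-\lambda_k)$,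 and define $$\widehat{M_g(f_k)}=(2\pi)^kT^{-k}\sum_{\tilde\lambda}\hat f_k(\tilde\lambda)\,g(\tilde\lambda)\,\Phi(\tilde\lambda),$$ where $\tilde\lambda$ runs over the vectors in $(-\pi,\pi]^k$ all of whose entries are Fourier frequencies $2\pi\ell/T$, $\ell\in\mathbb Z$, and $\Phi(\lambda)=1$ if no nonempty subfamily of $\lambda_1,\dots,\lambda_k$ has sum $\equiv 0 \pmod{2\pi}$, and $\Phi(\lambda)=0$ otherwise. Then, as $T\to\infty$, $$E\,\widehat{M_g(f_k)}=M_g(f_k)+o(1).$$ Moreover, with $g_T(\omega)=\sum_{\tilde\lambda}g(\tilde\lambda)\,\mathbf 1\big(\omega\in\tilde\lambda+(0,2\pi T^{-1}]^k\big)$ for $\omega\in(-\pi,\pi]^k$, the remainder is $O(T^{-1})$ provided that $\int_{(-\pi,\pi]^k}|g-g_T|=O(T^{-1})$. -/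

import Mathlib

open MeasureTheory Filter Asymptotics

noncomputable section

namespace Polyspectral

variable {Ω : Type*} [MeasurableSpace Ω]

/-- Stationarity of order `m`: moments of order `m` are finite and every joint moment
of order at most `m` is invariant under time shifts. -/
structure IsStationaryOfOrder (P : Measure Ω) (X : ℤ → Ω → ℝ) (m : ℕ) : Prop where
  memLp : ∀ t, MemLp (X t) m P
  moment_shift : ∀ r ≤ m, ∀ (t : Fin r → ℤ) (h : ℤ),
    ∫ ω, ∏ i, X (t i + h) ω ∂P = ∫ ω, ∏ i, X (t i) ω ∂P

/-- The joint cumulant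
`∑_π (-1)^(|π| - 1) (|π| - 1)! ∏_{b ∈ π} E ∏_{i ∈ b} Y i`, over all partitions `π` of the
index set. -/
def cumulant (P : Measure Ω) {n : ℕ} (Y : Fin n → Ω → ℝ) : ℝ :=
  ∑ π : Finpartition (Finset.univ : Finset (Fin n)),
    (-1 : ℝ) ^ (π.parts.card - 1) * ((π.parts.card - 1).factorial : ℝ) *
      ∏ b ∈ π.parts, ∫ ω, ∏ i ∈ b, Y i ω ∂P

/-- The autocumulant `γ(h₁, …, hₙ) = Cum(X_t, X_{t+h₁}, …, X_{t+hₙ})` of order `n + 1`, taken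
at `t = 0`; see `cumulant_shift_eq_autocumulant` for the independence of `t`. -/
def autocumulant (P : Measure Ω) (X : ℤ → Ω → ℝ) {n : ℕ} (h : Fin n → ℤ) : ℝ :=
  cumulant P (fun i => X ((Fin.cons 0 h : Fin (n + 1) → ℤ) i))

/-- Assumption A[r]: `∑_v |v_j γ(v₁, …, v_{r-1})| < ∞` for each `j`. -/
def AssumptionA (P : Measure Ω) (X : ℤ → Ω → ℝ) (r : ℕ) : Prop :=
  ∀ j : Fin (r - 1), Summable fun v : Fin (r - 1) → ℤ => |(v j : ℝ) * autocumulant P X v|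

/-- The polyspectrum `f_k(λ) = ∑_h γ(h) exp(-i h'λ)`. -/
def polyspectrum (P : Measure Ω) (X : ℤ → Ω → ℝ) (k : ℕ) (lam : Fin k → ℝ) : ℂ :=
  ∑' h : Fin k → ℤ,
    (autocumulant P X h : ℂ) * Complex.exp (-Complex.I * ((∑ j, (h j : ℝ) * lam j : ℝ) : ℂ))

/-- The cube `[-π, π]^k`. -/
def cube (k : ℕ) : Set (Fin k → ℝ) := Set.univ.pi fun _ => Set.Icc (-Real.pi) Real.pi

/-- The half-open cube `(-π, π]^k`. -/
def cubeIoc (k : ℕ) : Set (Fin k → ℝ) := Set.univ.pi fun _ => Set.Ioc (-Real.pi) Real.pi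

/-- The polyspectral mean `M_g(f_k) = ∫_{[-π, π]^k} f_k g`. -/
def polyMean (P : Measure Ω) (X : ℤ → Ω → ℝ) {k : ℕ} (g : (Fin k → ℝ) → ℂ) : ℂ :=
  ∫ lam in cube k, polyspectrum P X k lam * g lam

/-- The discrete Fourier transform `d(λ) = ∑_{t=1}^T X_t exp(-iλt)` of the sample. -/
def dft (X : ℤ → Ω → ℝ) (T : ℕ) (lam : ℝ) (ω : Ω) : ℂ :=
  ∑ t ∈ Finset.Icc 1 T, (X (t : ℤ) ω : ℂ) * Complex.exp (-Complex.I * ((lam * t : ℝ) : ℂ))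

/-- The periodogram of order `k`:
`T⁻¹ d(λ₁) ⋯ d(λ_k) d(-(λ₁ + ⋯ + λ_k))`. -/
def periodogram (X : ℤ → Ω → ℝ) (T : ℕ) {k : ℕ} (lam : Fin k → ℝ) (ω : Ω) : ℂ :=
  (T : ℂ)⁻¹ * (∏ j, dft X T (lam j) ω) * dft X T (-∑ j, lam j) ω

/-- The `ℓ ∈ {-⌊T/2⌋, …, ⌊T/2⌋}` for which `2πℓ/T` lies in `(-π, π]`. -/
def fourierIndices (T : ℕ) : Finset ℤ :=
  (Finset.Icc (-((T / 2 : ℕ) : ℤ)) ((T / 2 : ℕ) : ℤ)).filter fun l => -(T : ℤ) < 2 * l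

/-- The vector of Fourier frequencies `2πℓ_j/T`. -/
def fourierFreq (T : ℕ) {k : ℕ} (l : Fin k → ℤ) : Fin k → ℝ :=
  fun j => 2 * Real.pi * (l j : ℝ) / (T : ℝ)

/-- The indices of all `k`-vectors of Fourier frequencies. -/
def fourierGrid (T k : ℕ) : Finset (Fin k → ℤ) :=
  Fintype.piFinset fun _ => fourierIndices T

/-- No nonempty subset of the frequencies sums to `0` modulo `2π`. -/
def OffSubmanifolds {k : ℕ} (lam : Fin k → ℝ) : Prop :=
  ∀ s : Finset (Fin k), s.Nonempty → ∀ m : ℤ, ∑ j ∈ s, lam j ≠ 2 * Real.pi * (m : ℝ)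

open Classical in
/-- The indicator `Φ`. -/
def Phi {k : ℕ} (lam : Fin k → ℝ) : ℂ := if OffSubmanifolds lam then 1 else 0

/-- The estimator of `M_g(f_k)`:
`(2π)^k T^{-k} ∑ f̂_k(λ) g(λ) Φ(λ)` over the Fourier frequencies. -/
def polyMeanEstimator (X : ℤ → Ω → ℝ) {k : ℕ} (g : (Fin k → ℝ) → ℂ) (T : ℕ) (ω : Ω) : ℂ :=
  (2 * (Real.pi : ℂ)) ^ k * ((T : ℂ) ^ k)⁻¹ *
    ∑ l ∈ fourierGrid T k,
      periodogram X T (fourierFreq T l) ω * g (fourierFreq T l) * Phi (fourierFreq T l)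

/-- The discretization `g_T(ω) = ∑ g(λ) 1(ω ∈ λ + (0, 2π/T]^k)` over the Fourier
frequencies. -/
def discretization {k : ℕ} (g : (Fin k → ℝ) → ℂ) (T : ℕ) (w : Fin k → ℝ) : ℂ :=
  ∑ l ∈ fourierGrid T k,
    Set.indicator
      (Set.univ.pi fun j => Set.Ioc (fourierFreq T l j) (fourierFreq T l j + 2 * Real.pi / T))
      (fun _ => g (fourierFreq T l)) w

/-- Under stationarity of order `n + 1` the autocumulant does not depend on the base time. -/
theorem cumulant_shift_eq_autocumulant {P : Measure Ω} {X : ℤ → Ω → ℝ} {n : ℕ}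
    (hX : IsStationaryOfOrder P X (n + 1)) (h : Fin n → ℤ) (t : ℤ) :
    cumulant P (fun i => X (t + (Fin.cons 0 h : Fin (n + 1) → ℤ) i)) = autocumulant P X h := by
  unfold autocumulant cumulant
  refine Finset.sum_congr rfl fun π _ => ?_
  congr 1
  refine Finset.prod_congr rfl fun b _ => ?_
  have hb : b.card ≤ n + 1 := by simpa using Finset.card_le_univ b
  have key := hX.moment_shift b.card hb
    (fun i => (Fin.cons 0 h : Fin (n + 1) → ℤ) (b.equivFin.symm i)) t
  have e : ∀ F : Fin (n + 1) → ℝ,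
      ∏ i : Fin b.card, F (b.equivFin.symm i) = ∏ i ∈ b, F i := fun F => by
    rw [Equiv.prod_comp b.equivFin.symm (fun x : b => F x), Finset.prod_coe_sort]
  have e1 := fun ω => e (fun i => X (t + (Fin.cons 0 h : Fin (n + 1) → ℤ) i) ω)
  have e2 := fun ω => e (fun i => X ((Fin.cons 0 h : Fin (n + 1) → ℤ) i) ω)
  simp only [← e1, ← e2]
  simpa only [add_comm t] using key

end Polyspectral

end

/-!
By multilinearity the joint cumulant of `d(λ₀), …, d(λ_k)` is the sum over `t ∈ {1, …, T}^(k+1)` of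
`Cum(X_{t₀}, …, X_{t_k}) e(t₀λ₀ + ⋯ + t_kλ_k)`. Under stationarity, summing over the differences
`t_j - t₀` first gives `D_T(λ₀ + ⋯ + λ_k) f_k(λ₁, …, λ_k)`, where `D_T` is the Dirichlet kernel, up
to the contribution of the pairs `(t₀, v)` with `t₀ + v_j ∉ {1, …, T}` for some `j`; this is at most
`∑ |γ(v)| (|v₁| + ⋯ + |v_k|)`.

`D_T` vanishes at the nonzero Fourier frequencies. Off the submanifolds, every proper nonempty
subfamily of `-(λ₁ + ⋯ + λ_k), λ₁, …, λ_k` has a nonzero sum, so by induction on the order the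
moments of the proper subfamilies of the transforms are bounded and the full moment is within `O(1)`
of the cumulant, where `D_T(0) = T`. Hence `E f̂_k = f_k + O(1/T)`, uniformly.

Only `O(T^(k-1))` grid points lie on the submanifolds, so `E M̂_g(f_k)` is the Riemann sum of
`f_k g` up to `O(1/T)`. As `f_k` is bounded and Lipschitz, this Riemann sum differs from `M_g(f_k)`
by at most a multiple of `‖g - g_T‖₁` plus `O(1/T)`, and `g_T → g` in `L¹` by dominated convergence.
-/

namespace Polyspectral

section DirichletKernel

/-- The character `x ↦ exp(-ix)` of the real line. -/
noncomputable def expNegI : AddChar ℝ ℂ where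
  toFun x := Complex.exp (-Complex.I * x)
  map_zero_eq_one' := by simp
  map_add_eq_mul' x y := by rw [Complex.ofReal_add, mul_add, Complex.exp_add]

lemma expNegI_apply (x : ℝ) : expNegI x = Complex.exp (-Complex.I * x) := rfl

lemma expNegI_sum {ι : Type*} (s : Finset ι) (x : ι → ℝ) :
    expNegI (∑ i ∈ s, x i) = ∏ i ∈ s, expNegI (x i) :=
  map_sum expNegI.toAddMonoidHom x s

lemma expNegI_eq_exp_I_mul_neg (x : ℝ) : expNegI x = Complex.exp (Complex.I * (-x : ℝ)) := by
  rw [expNegI_apply, Complex.ofReal_neg, mul_neg, neg_mul]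

lemma norm_expNegI (x : ℝ) : ‖expNegI x‖ = 1 := by
  rw [expNegI_eq_exp_I_mul_neg, Complex.norm_exp_I_mul_ofReal]

lemma norm_expNegI_sub_le (x y : ℝ) : ‖expNegI x - expNegI y‖ ≤ |x - y| := by
  have hfactor : expNegI x - expNegI y = expNegI y * (expNegI (x - y) - 1) := by
    rw [mul_sub, ← AddChar.map_add_eq_mul, add_sub_cancel, mul_one]
  rw [hfactor, norm_mul, norm_expNegI, one_mul, expNegI_eq_exp_I_mul_neg, ← abs_neg (x - y)]
  exact Real.norm_exp_I_mul_ofReal_sub_one_le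

lemma expNegI_eq_one_iff {x : ℝ} : expNegI x = 1 ↔ ∃ m : ℤ, x = 2 * Real.pi * m := by
  rw [expNegI_apply, Complex.exp_eq_one_iff]
  refine (Equiv.neg ℤ).exists_congr fun m => ?_
  rw [Equiv.neg_apply, show (m : ℂ) * (2 * Real.pi * Complex.I) =
    -Complex.I * (2 * Real.pi * (-m : ℤ) : ℝ) by push_cast; ring,
    mul_right_inj' (neg_ne_zero.2 Complex.I_ne_zero), Complex.ofReal_inj]

lemma sum_Icc_one_natCast {M : Type*} [AddCommMonoid M] (f : ℤ → M) (T : ℕ) :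
    ∑ t ∈ Finset.Icc 1 T, f t = ∑ t ∈ Finset.Icc (1 : ℤ) T, f t := by
  refine Finset.sum_nbij' Nat.cast Int.toNat (fun t ht => ?_) (fun t ht => ?_) (fun t _ => ?_)
    (fun t ht => ?_) fun t _ => rfl <;> simp only [Finset.mem_Icc] at * <;> omega

/-- The Dirichlet kernel `D_T(θ) = ∑_{t=1}^T exp(-iθt)`, with `t` ranging over integers so that
the sample can be shifted. -/
noncomputable def dirichletKernel (T : ℕ) (θ : ℝ) : ℂ :=
  ∑ t ∈ Finset.Icc (1 : ℤ) T, expNegI (θ * t)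

lemma dirichletKernel_zero (T : ℕ) : dirichletKernel T 0 = T := by
  simp [dirichletKernel]

lemma dirichletKernel_neg (T : ℕ) (θ : ℝ) :
    dirichletKernel T (-θ) = (starRingEnd ℂ) (dirichletKernel T θ) := by
  simp only [dirichletKernel, map_sum]
  refine Finset.sum_congr rfl fun t _ => ?_
  simp only [expNegI_apply, ← Complex.exp_conj, map_mul, map_neg, Complex.conj_I,
    Complex.conj_ofReal, neg_mul, Complex.ofReal_neg, mul_neg]

lemma dirichletKernel_eq_zero {T : ℕ} {θ : ℝ} (hT : expNegI (T * θ) = 1) (hθ : expNegI θ ≠ 1) :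
    dirichletKernel T θ = 0 := by
  have hpow : ∀ t : ℕ, expNegI (θ * ((t : ℤ) : ℝ)) = expNegI θ ^ t := fun t => by
    rw [← AddChar.map_nsmul_eq_pow, nsmul_eq_mul, mul_comm, Int.cast_natCast]
  rw [dirichletKernel, ← sum_Icc_one_natCast fun t => expNegI (θ * t)]
  simp only [hpow]
  rw [← Finset.Ico_add_one_right_eq_Icc, geom_sum_Ico hθ (Nat.le_add_left 1 T), pow_succ,
    ← AddChar.map_nsmul_eq_pow, nsmul_eq_mul, hT, one_mul, pow_one, sub_self, zero_div]

lemma OffSubmanifolds.dirichletKernel_sum_eq_zero {T k : ℕ} {l : Fin k → ℤ}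
    (hl : OffSubmanifolds (fourierFreq T l)) {s : Finset (Fin k)} (hs : s.Nonempty) :
    dirichletKernel T (∑ j ∈ s, fourierFreq T l j) = 0 := by
  rcases eq_or_ne T 0 with rfl | hT
  · simp [dirichletKernel]
  refine dirichletKernel_eq_zero (expNegI_eq_one_iff.2 ⟨∑ j ∈ s, l j, ?_⟩) fun h => ?_
  · have hT0 : (T : ℝ) ≠ 0 := Nat.cast_ne_zero.2 hT
    simp only [fourierFreq, ← Finset.sum_div, ← Finset.mul_sum, Int.cast_sum]
    field_simp
  · obtain ⟨m, hm⟩ := expNegI_eq_one_iff.1 h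
    exact hl s hs m hm

end DirichletKernel

section Moments

variable {Ω ι : Type*} [Fintype ι] {X : ℤ → Ω → ℝ}

lemma dft_eq_sum_Icc_int (X : ℤ → Ω → ℝ) (T : ℕ) (lam : ℝ) (ω : Ω) :
    dft X T lam ω = ∑ t ∈ Finset.Icc (1 : ℤ) T, (X t ω : ℂ) * expNegI (lam * t) :=
  sum_Icc_one_natCast (fun t => (X t ω : ℂ) * expNegI (lam * t)) T

lemma prod_dft_eq_sum [DecidableEq ι] (X : ℤ → Ω → ℝ) (T : ℕ) (lam : ι → ℝ) (ω : Ω) :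
    ∏ i, dft X T (lam i) ω =
      ∑ t ∈ Fintype.piFinset fun _ : ι => Finset.Icc (1 : ℤ) T,
        ((∏ i, X (t i) ω : ℝ) : ℂ) * ∏ i, expNegI (lam i * t i) := by
  simp only [dft_eq_sum_Icc_int, Finset.prod_univ_sum, Finset.prod_mul_distrib,
    Complex.ofReal_prod]

variable [MeasurableSpace Ω] {P : Measure Ω} [IsFiniteMeasure P] {m : ℕ}

lemma IsStationaryOfOrder.mono (hX : IsStationaryOfOrder P X m) {n : ℕ} (h : n ≤ m) :
    IsStationaryOfOrder P X n where
  memLp t := (hX.memLp t).mono_exponent (mod_cast h)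
  moment_shift r hr := hX.moment_shift r (hr.trans h)

lemma IsStationaryOfOrder.integrable_prod (hX : IsStationaryOfOrder P X m)
    (hι : Fintype.card ι ≤ m) (t : ι → ℤ) : Integrable (fun ω => ∏ i, X (t i) ω) P := by
  refine memLp_one_iff_integrable.1
    ((MemLp.prod' (p := fun _ => m) fun i (_ : i ∈ Finset.univ) => hX.memLp (t i)).mono_exponent ?_)
  rw [ENNReal.one_le_inv, Finset.sum_const, Finset.card_univ, nsmul_eq_mul, ← div_eq_mul_inv]
  refine ENNReal.div_le_of_le_mul ?_
  rw [one_mul]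
  exact_mod_cast hι

lemma IsStationaryOfOrder.integrable_prod_dft (hX : IsStationaryOfOrder P X m)
    (hι : Fintype.card ι ≤ m) (T : ℕ) (lam : ι → ℝ) :
    Integrable (fun ω => ∏ i, dft X T (lam i) ω) P := by
  classical
  simp only [prod_dft_eq_sum]
  exact integrable_finsetSum _ fun t _ => (hX.integrable_prod hι t).ofReal.mul_const _

lemma IsStationaryOfOrder.integral_prod_dft [DecidableEq ι] (hX : IsStationaryOfOrder P X m)
    (hι : Fintype.card ι ≤ m) (T : ℕ) (lam : ι → ℝ) :
    ∫ ω, ∏ i, dft X T (lam i) ω ∂P =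
      ∑ t ∈ Fintype.piFinset fun _ : ι => Finset.Icc (1 : ℤ) T,
        ((∫ ω, ∏ i, X (t i) ω ∂P : ℝ) : ℂ) * ∏ i, expNegI (lam i * t i) := by
  simp only [prod_dft_eq_sum]
  rw [integral_finsetSum _ fun t _ => (hX.integrable_prod hι t).ofReal.mul_const _]
  simp only [integral_mul_const, integral_complex_ofReal]

end Moments

section Partitions

variable {ι κ 𝕜 : Type*} [Fintype ι] [DecidableEq ι]

lemma prod_parts_sum [CommSemiring 𝕜] (π : Finpartition (Finset.univ : Finset ι)) (A : Finset κ)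
    (G : (b : Finset ι) → (b → κ) → 𝕜) :
    ∏ b ∈ π.parts, ∑ u ∈ Fintype.piFinset fun _ : b => A, G b u =
      ∑ t ∈ Fintype.piFinset fun _ : ι => A, ∏ b ∈ π.parts, G b fun i => t i := by
  classical
  let glue (p : (b : π.parts) → b.1 → κ) (i : ι) : κ :=
    p ⟨π.part i, π.part_mem.2 (Finset.mem_univ i)⟩ ⟨i, π.mem_part (Finset.mem_univ i)⟩
  have glue_apply (p : (b : π.parts) → b.1 → κ) (b : π.parts) :
      (fun i : b.1 => glue p i) = p b := by
    funext ⟨i, hi⟩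
    obtain ⟨b, hb⟩ := b
    obtain rfl : π.part i = b := π.part_eq_of_mem hb hi
    rfl
  rw [← Finset.prod_coe_sort, Finset.prod_univ_sum]
  refine Finset.sum_nbij' glue (fun t b i => t i) (fun p hp => ?_) (fun t ht => ?_)
    (fun p _ => funext (glue_apply p)) (fun _ _ => rfl) fun p _ => ?_
  · simp only [Fintype.mem_piFinset] at hp ⊢
    exact fun i => hp _ _
  · simp only [Fintype.mem_piFinset] at ht ⊢
    exact fun _ i => ht i
  · rw [← Finset.prod_coe_sort π.parts fun b => G b fun i => glue p i]
    exact Finset.prod_congr rfl fun b _ => congrArg (G b) (glue_apply p b).symm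

variable [CommRing 𝕜]

/-- The cumulant expressed through the moments `M b` of the subsets `b` of the index set. -/
def cumulantOfMoments (M : Finset ι → 𝕜) : 𝕜 :=
  ∑ π : Finpartition (Finset.univ : Finset ι),
    (-1) ^ (π.parts.card - 1) * ((π.parts.card - 1).factorial : 𝕜) * ∏ b ∈ π.parts, M b

lemma ofReal_cumulant {Ω : Type*} [MeasurableSpace Ω] (P : Measure Ω) {n : ℕ}
    (Y : Fin n → Ω → ℝ) :
    (cumulant P Y : ℂ) = cumulantOfMoments fun b => ((∫ ω, ∏ i ∈ b, Y i ω ∂P : ℝ) : ℂ) := by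
  simp [cumulant, cumulantOfMoments]

lemma cumulantOfMoments_sum_piFinset (A : Finset κ) (m : (b : Finset ι) → (b → κ) → 𝕜)
    (c : ι → κ → 𝕜) :
    cumulantOfMoments (fun b => ∑ u ∈ Fintype.piFinset fun _ : b => A,
        m b u * ∏ i : b, c i (u i)) =
      ∑ t ∈ Fintype.piFinset fun _ : ι => A,
        cumulantOfMoments (fun b => m b fun i => t i) * ∏ i, c i (t i) := by
  have hprod (π : Finpartition (Finset.univ : Finset ι)) (t : ι → κ) :
      ∏ b ∈ π.parts, ∏ i : b, c i (t i) = ∏ i, c i (t i) := by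
    rw [← Finset.prod_congr π.biUnion_parts fun _ _ => rfl,
      Finset.prod_biUnion π.supIndep.pairwiseDisjoint]
    exact Finset.prod_congr rfl fun b _ => Finset.prod_coe_sort b fun i => c i (t i)
  simp only [cumulantOfMoments, Finset.sum_mul]
  rw [Finset.sum_comm]
  refine Finset.sum_congr rfl fun π _ => ?_
  rw [prod_parts_sum π A fun b u => m b u * ∏ i : b, c i (u i), Finset.mul_sum]
  simp only [Finset.prod_mul_distrib, hprod, mul_assoc]

lemma ne_univ_of_mem_parts [Nonempty ι] {π : Finpartition (Finset.univ : Finset ι)}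
    (hπ : π ≠ Finpartition.indiscrete Finset.univ_nonempty.ne_empty) {b : Finset ι}
    (hb : b ∈ π.parts) : b ≠ Finset.univ := by
  rintro rfl
  refine hπ (Finpartition.ext ?_)
  rw [Finpartition.indiscrete_parts]
  refine Finset.eq_singleton_iff_unique_mem.2 ⟨hb, fun c hc => ?_⟩
  obtain ⟨i, hi⟩ := π.nonempty_of_mem_parts hc
  exact π.eq_of_mem_parts hc hb hi (Finset.mem_univ i)

lemma exists_norm_sub_cumulantOfMoments_le [Nonempty ι] (C : ℝ) :
    ∃ K : ℝ, 0 ≤ K ∧ ∀ M : Finset ι → ℂ,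
      (∀ b : Finset ι, b.Nonempty → b ≠ Finset.univ → ‖M b‖ ≤ C) →
      ‖M Finset.univ - cumulantOfMoments M‖ ≤ K := by
  set π₀ := Finpartition.indiscrete (Finset.univ_nonempty (α := ι)).ne_empty
  refine ⟨∑ π ∈ Finset.univ.erase π₀, ((π.parts.card - 1).factorial : ℝ) * |C| ^ π.parts.card,
    by positivity, fun M hM => ?_⟩
  have hπ₀ : (-1) ^ (π₀.parts.card - 1) * ((π₀.parts.card - 1).factorial : ℂ) *
      ∏ b ∈ π₀.parts, M b = M Finset.univ := by
    simp [π₀]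
  rw [cumulantOfMoments, ← Finset.add_sum_erase _ _ (Finset.mem_univ π₀), hπ₀,
    sub_add_cancel_left, norm_neg]
  refine norm_sum_le_of_le _ fun π hπ => ?_
  rw [norm_mul, norm_mul, norm_pow, norm_neg, norm_one, one_pow, one_mul, Complex.norm_natCast,
    norm_prod, ← Finset.prod_const]
  gcongr with b hb
  exact (hM b (π.nonempty_of_mem_parts hb)
    (ne_univ_of_mem_parts (Finset.ne_of_mem_erase hπ) hb)).trans (le_abs_self C)

end Partitions

lemma IsStationaryOfOrder.cumulantOfMoments_dft {Ω : Type*} [MeasurableSpace Ω] {P : Measure Ω}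
    [IsFiniteMeasure P] {X : ℤ → Ω → ℝ} {n : ℕ} (hX : IsStationaryOfOrder P X n) (T : ℕ)
    (lam : Fin n → ℝ) :
    cumulantOfMoments (fun b => ∫ ω, ∏ i ∈ b, dft X T (lam i) ω ∂P) =
      ∑ t ∈ Fintype.piFinset fun _ : Fin n => Finset.Icc (1 : ℤ) T,
        (cumulant P (fun i => X (t i)) : ℂ) * ∏ i, expNegI (lam i * t i) := by
  have hcard (b : Finset (Fin n)) : Fintype.card b ≤ n := by
    simpa using Finset.card_le_univ b
  have hdft (b : Finset (Fin n)) :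
      ∫ ω, ∏ i ∈ b, dft X T (lam i) ω ∂P = ∫ ω, ∏ i : b, dft X T (lam i) ω ∂P := by
    congr with ω
    exact (Finset.prod_coe_sort b fun i => dft X T (lam i) ω).symm
  have hmoment (b : Finset (Fin n)) (t : Fin n → ℤ) :
      ∫ ω, ∏ i ∈ b, X (t i) ω ∂P = ∫ ω, ∏ i : b, X (t i) ω ∂P := by
    congr with ω
    exact (Finset.prod_coe_sort b fun i => X (t i) ω).symm
  simp only [hdft, hX.integral_prod_dft (hcard _), ofReal_cumulant, hmoment]
  exact cumulantOfMoments_sum_piFinset _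
    (fun b u => ((∫ ω, ∏ i : b, X (u i) ω ∂P : ℝ) : ℂ)) fun i t => expNegI (lam i * t)

section ShiftedBoxes

variable {ι : Type*} [Fintype ι]

lemma card_filter_shift_notMem_Icc_le (T : ℕ) (v : ℤ) :
    ((Finset.Icc (1 : ℤ) T).filter fun s => v + s ∉ Finset.Icc (1 : ℤ) T).card ≤ v.natAbs := by
  rcases le_total 0 v with hv | hv
  · calc _ ≤ (Finset.Ioc (T - v) T).card := Finset.card_le_card fun s hs => by
          simp only [Finset.mem_filter, Finset.mem_Icc, Finset.mem_Ioc] at hs ⊢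
          omega
      _ ≤ _ := by rw [Int.card_Ioc]; omega
  · calc _ ≤ (Finset.Icc 1 (-v)).card := Finset.card_le_card fun s hs => by
          simp only [Finset.mem_filter, Finset.mem_Icc] at hs ⊢
          omega
      _ ≤ _ := by rw [Int.card_Icc]; omega

lemma card_filter_exists_shift_notMem_Icc_le (T : ℕ) (v : ι → ℤ) :
    ((Finset.Icc (1 : ℤ) T).filter fun s => ∃ j, v j + s ∉ Finset.Icc (1 : ℤ) T).card ≤
      ∑ j, (v j).natAbs := by
  classical
  calc _ ≤ (Finset.univ.biUnion fun j =>
        (Finset.Icc (1 : ℤ) T).filter fun s => v j + s ∉ Finset.Icc (1 : ℤ) T).card :=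
        Finset.card_le_card fun s hs => by simpa using hs
    _ ≤ ∑ j, (v j).natAbs := Finset.card_biUnion_le.trans
        (Finset.sum_le_sum fun j _ => card_filter_shift_notMem_Icc_le T (v j))

variable {E : Type*} [NormedAddCommGroup E] [CompleteSpace E] {a : (ι → ℤ) → E}

lemma norm_sum_piFinset_sub_tsum_le [DecidableEq ι] (ha : Summable fun v => ‖a v‖) (A : Finset ℤ)
    (s : ℤ) :
    ‖∑ u ∈ Fintype.piFinset fun _ : ι => A, a (fun j => u j - s) - ∑' v, a v‖ ≤
      ∑' v, {v : ι → ℤ | ∃ j, v j + s ∉ A}.indicator (fun v => ‖a v‖) v := by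
  set out : Set (ι → ℤ) := {v | ∃ j, v j + s ∉ A}
  have hbox : ∑ u ∈ Fintype.piFinset fun _ : ι => A, a (fun j => u j - s) =
      ∑' v, outᶜ.indicator a v := by
    rw [sum_eq_tsum_indicator, ← (Equiv.addRight fun _ : ι => s).tsum_eq]
    refine tsum_congr fun v => ?_
    simp only [Set.indicator_apply]
    congr 1
    · simp [out]
    · simp
  rw [hbox, ← norm_neg, neg_sub, ← ha.of_norm.tsum_sub (ha.of_norm.indicator _)]
  refine tsum_of_norm_bounded (ha.indicator out).hasSum fun v => ?_
  by_cases hv : v ∈ out <;> simp [hv]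

lemma sum_norm_sum_piFinset_sub_tsum_le [DecidableEq ι] (ha : Summable fun v => ‖a v‖)
    (ha' : Summable fun v => ‖a v‖ * ∑ j, |(v j : ℝ)|) (T : ℕ) :
    ∑ s ∈ Finset.Icc (1 : ℤ) T,
        ‖∑ u ∈ Fintype.piFinset fun _ : ι => Finset.Icc (1 : ℤ) T, a (fun j => u j - s) -
          ∑' v, a v‖ ≤
      ∑' v, ‖a v‖ * ∑ j, |(v j : ℝ)| := by
  refine (Finset.sum_le_sum fun s _ => norm_sum_piFinset_sub_tsum_le ha _ s).trans ?_
  rw [← Summable.tsum_finsetSum fun s _ => ha.indicator _]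
  refine Summable.tsum_le_tsum (fun v => ?_) (summable_sum fun s _ => ha.indicator _) ha'
  simp only [Set.indicator_apply, Set.mem_ofPred_eq]
  rw [← Finset.sum_filter, Finset.sum_const, nsmul_eq_mul, mul_comm]
  refine mul_le_mul_of_nonneg_left ?_ (norm_nonneg _)
  simp only [← Int.cast_abs, Int.abs_eq_natAbs, Int.cast_natCast]
  exact_mod_cast card_filter_exists_shift_notMem_Icc_le T v

end ShiftedBoxes

lemma sum_piFinset_cons {κ M : Type*} [AddCommMonoid M] {m : ℕ} (A : Finset κ)
    (F : (Fin (m + 1) → κ) → M) :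
    ∑ t ∈ Fintype.piFinset fun _ : Fin (m + 1) => A, F t =
      ∑ s ∈ A, ∑ u ∈ Fintype.piFinset fun _ : Fin m => A, F (Fin.cons s u) := by
  rw [← Finset.sum_product']
  refine (Finset.sum_equiv (Fin.consEquiv fun _ => κ) (fun p => ?_) fun _ _ => rfl).symm
  simp [Fintype.mem_piFinset, Fin.forall_fin_succ]

section Autocumulants

variable {Ω : Type*} [MeasurableSpace Ω] {P : Measure Ω} {X : ℤ → Ω → ℝ} {m : ℕ}

variable (P X m) in
/-- The mass `∑_v |γ(v₁, …, v_m)|`, a bound for the polyspectrum. -/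
noncomputable def autocumulantMass : ℝ := ∑' v : Fin m → ℤ, |autocumulant P X v|

variable (P X m) in
/-- The first absolute moment `∑_v |γ(v₁, …, v_m)| (|v₁| + ⋯ + |v_m|)`, a Lipschitz constant of the
polyspectrum. -/
noncomputable def autocumulantMoment : ℝ :=
  ∑' v : Fin m → ℤ, |autocumulant P X v| * ∑ j, |(v j : ℝ)|

variable (P X) in
/-- The general term `γ(h) exp(-i h'λ)` of the Fourier series of the polyspectrum. -/
noncomputable def polyspectrumTerm (lam : Fin m → ℝ) (h : Fin m → ℤ) : ℂ :=
  (autocumulant P X h : ℂ) * expNegI (∑ j, (h j : ℝ) * lam j)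

lemma polyspectrum_eq_tsum (lam : Fin m → ℝ) :
    polyspectrum P X m lam = ∑' h, polyspectrumTerm P X lam h := rfl

lemma norm_polyspectrumTerm (lam : Fin m → ℝ) (h : Fin m → ℤ) :
    ‖polyspectrumTerm P X lam h‖ = |autocumulant P X h| := by
  rw [polyspectrumTerm, norm_mul, norm_expNegI, mul_one, Complex.norm_real, Real.norm_eq_abs]

lemma norm_polyspectrumTerm_sub_le (x y : Fin m → ℝ) (h : Fin m → ℤ) :
    ‖polyspectrumTerm P X x h - polyspectrumTerm P X y h‖ ≤
      |autocumulant P X h| * (∑ j, |(h j : ℝ)|) * dist x y := by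
  rw [polyspectrumTerm, polyspectrumTerm, ← mul_sub, norm_mul, Complex.norm_real,
    Real.norm_eq_abs, mul_assoc]
  gcongr
  refine (norm_expNegI_sub_le _ _).trans ?_
  rw [← Finset.sum_sub_distrib, Finset.sum_mul]
  refine (Finset.abs_sum_le_sum_abs _ _).trans (Finset.sum_le_sum fun j _ => ?_)
  rw [← mul_sub, abs_mul, ← Real.dist_eq]
  gcongr
  exact dist_le_pi_dist x y j

namespace AssumptionA

lemma summable_abs_mul_sum (hA : AssumptionA P X (m + 1)) :
    Summable fun v : Fin m → ℤ => |autocumulant P X v| * ∑ j, |(v j : ℝ)| := by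
  refine (summable_sum (s := Finset.univ) fun j _ => hA j).congr fun v => ?_
  rw [Finset.mul_sum]
  exact Finset.sum_congr rfl fun j _ => by rw [abs_mul, mul_comm]

lemma summable_abs (hA : AssumptionA P X (m + 1)) :
    Summable fun v : Fin m → ℤ => |autocumulant P X v| := by
  refine hA.summable_abs_mul_sum.of_norm_bounded_eventually ?_
  filter_upwards [(Set.finite_singleton (0 : Fin m → ℤ)).compl_mem_cofinite] with v hv
  obtain ⟨j, hj⟩ := Function.ne_iff.1 hv
  have hone : (1 : ℝ) ≤ |(v j : ℝ)| := mod_cast Int.one_le_abs hj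
  rw [Real.norm_eq_abs, abs_abs]
  refine le_mul_of_one_le_right (abs_nonneg _) (hone.trans ?_)
  exact Finset.single_le_sum (f := fun j => |(v j : ℝ)|) (fun _ _ => abs_nonneg _)
    (Finset.mem_univ j)

lemma summable_norm_polyspectrumTerm (hA : AssumptionA P X (m + 1)) (lam : Fin m → ℝ) :
    Summable fun v => ‖polyspectrumTerm P X lam v‖ := by
  simpa only [norm_polyspectrumTerm] using hA.summable_abs

lemma norm_polyspectrum_le (hA : AssumptionA P X (m + 1)) (lam : Fin m → ℝ) :
    ‖polyspectrum P X m lam‖ ≤ autocumulantMass P X m :=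
  tsum_of_norm_bounded hA.summable_abs.hasSum fun h => (norm_polyspectrumTerm lam h).le

lemma lipschitzWith_polyspectrum (hA : AssumptionA P X (m + 1)) :
    LipschitzWith (autocumulantMoment P X m).toNNReal (polyspectrum P X m) := by
  refine LipschitzWith.of_dist_le' fun x y => ?_
  rw [dist_eq_norm, polyspectrum_eq_tsum, polyspectrum_eq_tsum,
    ← (hA.summable_norm_polyspectrumTerm x).of_norm.tsum_sub
      (hA.summable_norm_polyspectrumTerm y).of_norm]
  exact tsum_of_norm_bounded (hA.summable_abs_mul_sum.hasSum.mul_right _)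
    (norm_polyspectrumTerm_sub_le x y)

end AssumptionA

lemma IsStationaryOfOrder.cumulant_eq_autocumulant (hX : IsStationaryOfOrder P X (m + 1))
    (t : Fin (m + 1) → ℤ) :
    cumulant P (fun i => X (t i)) = autocumulant P X fun j => t j.succ - t 0 := by
  rw [← cumulant_shift_eq_autocumulant hX _ (t 0)]
  congr 1 with i : 1
  cases i using Fin.cases <;> simp

lemma prod_expNegI_mul (lam : Fin (m + 1) → ℝ) (t : Fin (m + 1) → ℤ) :
    ∏ i, expNegI (lam i * t i) = expNegI ((∑ i, lam i) * t 0) *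
      expNegI (∑ j : Fin m, ((t j.succ - t 0 : ℤ) : ℝ) * Fin.tail lam j) := by
  rw [← expNegI_sum, ← AddChar.map_add_eq_mul, Fin.sum_univ_succ, Fin.sum_univ_succ,
    add_mul, add_assoc, Finset.sum_mul, ← Finset.sum_add_distrib]
  congr 2
  refine Finset.sum_congr rfl fun j _ => ?_
  rw [Fin.tail, Int.cast_sub]
  ring

lemma IsStationaryOfOrder.norm_sum_cumulant_sub_le (hX : IsStationaryOfOrder P X (m + 1))
    (hA : AssumptionA P X (m + 1)) (T : ℕ) (lam : Fin (m + 1) → ℝ) :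
    ‖∑ t ∈ Fintype.piFinset fun _ : Fin (m + 1) => Finset.Icc (1 : ℤ) T,
        (cumulant P (fun i => X (t i)) : ℂ) * ∏ i, expNegI (lam i * t i) -
      dirichletKernel T (∑ i, lam i) * polyspectrum P X m (Fin.tail lam)‖ ≤
      autocumulantMoment P X m := by
  have hterm (s : ℤ) (u : Fin m → ℤ) :
      (cumulant P (fun i => X ((Fin.cons s u : Fin (m + 1) → ℤ) i)) : ℂ) *
          ∏ i, expNegI (lam i * (Fin.cons s u : Fin (m + 1) → ℤ) i) =
        expNegI ((∑ i, lam i) * s) * polyspectrumTerm P X (Fin.tail lam) fun j => u j - s := by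
    rw [hX.cumulant_eq_autocumulant, prod_expNegI_mul, mul_left_comm, polyspectrumTerm]
    simp only [Fin.cons_zero, Fin.cons_succ]
  have hbox := sum_norm_sum_piFinset_sub_tsum_le
    (hA.summable_norm_polyspectrumTerm (Fin.tail lam))
    (by simpa only [norm_polyspectrumTerm] using hA.summable_abs_mul_sum) T
  simp only [norm_polyspectrumTerm] at hbox
  simp only [sum_piFinset_cons, hterm, ← Finset.mul_sum]
  rw [dirichletKernel, Finset.sum_mul, ← Finset.sum_sub_distrib]
  refine (norm_sum_le_of_le _ fun s _ => ?_).trans hbox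
  rw [← mul_sub, norm_mul, norm_expNegI, one_mul, polyspectrum_eq_tsum]

end Autocumulants

section Balanced

variable {k : ℕ}

/-- The frequencies `λ₁, …, λ_k` preceded by `λ₀ = -(λ₁ + ⋯ + λ_k)`; these are the `k + 1`
frequencies entering the periodogram. -/
def balanced (lam : Fin k → ℝ) : Fin (k + 1) → ℝ := Fin.cons (-∑ j, lam j) lam

lemma sum_balanced (lam : Fin k → ℝ) : ∑ i, balanced lam i = 0 := by
  simp [balanced, Fin.sum_univ_succ]

lemma tail_balanced (lam : Fin k → ℝ) : Fin.tail (balanced lam) = lam := Fin.tail_cons _ _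

lemma periodogram_eq_prod {Ω : Type*} (X : ℤ → Ω → ℝ) (T : ℕ) (lam : Fin k → ℝ) (ω : Ω) :
    periodogram X T lam ω = (T : ℂ)⁻¹ * ∏ i, dft X T (balanced lam i) ω := by
  simp only [periodogram, balanced, Fin.prod_univ_succ, Fin.cons_zero, Fin.cons_succ]
  ring

lemma dirichletKernel_sum_balanced_eq_zero {T : ℕ} {lam : Fin k → ℝ}
    (h : ∀ s : Finset (Fin k), s.Nonempty → dirichletKernel T (∑ j ∈ s, lam j) = 0)
    {s : Finset (Fin (k + 1))} (hs : s.Nonempty) (hsu : s ≠ Finset.univ) :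
    dirichletKernel T (∑ i ∈ s, balanced lam i) = 0 := by
  have hzero_notMem (u : Finset (Fin (k + 1))) (hu : u.Nonempty) (h0 : 0 ∉ u) :
      dirichletKernel T (∑ i ∈ u, balanced lam i) = 0 := by
    have hmap : u = (Finset.univ.filter fun j : Fin k => j.succ ∈ u).map (Fin.succEmb k) := by
      ext i
      cases i using Fin.cases <;> simp [h0]
    rw [hmap, Finset.sum_map]
    rw [hmap, Finset.map_nonempty] at hu
    exact h _ hu
  by_cases h0 : 0 ∈ s
  · have hcompl : ∑ i ∈ s, balanced lam i = -∑ i ∈ sᶜ, balanced lam i := by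
      rw [eq_neg_iff_add_eq_zero, Finset.sum_add_sum_compl, sum_balanced]
    rw [hcompl, dirichletKernel_neg, hzero_notMem sᶜ _ (by simpa using h0), map_zero]
    rwa [Finset.nonempty_iff_ne_empty, Ne, Finset.compl_eq_empty_iff]
  · exact hzero_notMem s hs h0

end Balanced

section Expectation

variable {Ω : Type*} [MeasurableSpace Ω] {P : Measure Ω} [IsFiniteMeasure P] {X : ℤ → Ω → ℝ}
  {k : ℕ}

lemma exists_norm_integral_prod_dft_sub_le (hX : IsStationaryOfOrder P X (k + 1))
    (hA : AssumptionA P X (k + 1)) (C : ℝ) :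
    ∃ K : ℝ, 0 ≤ K ∧ ∀ (T : ℕ) (lam : Fin (k + 1) → ℝ),
      (∀ b : Finset (Fin (k + 1)), b.Nonempty → b ≠ Finset.univ →
        ‖∫ ω, ∏ i ∈ b, dft X T (lam i) ω ∂P‖ ≤ C) →
      ‖∫ ω, ∏ i, dft X T (lam i) ω ∂P -
        dirichletKernel T (∑ i, lam i) * polyspectrum P X k (Fin.tail lam)‖ ≤ K := by
  obtain ⟨K, hK0, hK⟩ := exists_norm_sub_cumulantOfMoments_le (ι := Fin (k + 1)) C
  refine ⟨K + autocumulantMoment P X k,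
    add_nonneg hK0 (tsum_nonneg fun v => by positivity), fun T lam hlam => ?_⟩
  have hmoment := hK (fun b => ∫ ω, ∏ i ∈ b, dft X T (lam i) ω ∂P) hlam
  rw [hX.cumulantOfMoments_dft] at hmoment
  exact (norm_sub_le_norm_sub_add_norm_sub _ _ _).trans
    (add_le_add hmoment (hX.norm_sum_cumulant_sub_le hA T lam))

lemma exists_norm_integral_prod_dft_le (hX : IsStationaryOfOrder P X k)
    (hA : ∀ m < k, AssumptionA P X (m + 1)) :
    ∃ C : ℝ, ∀ {n : ℕ} (b : Finset (Fin n)), b.card ≤ k → ∀ (T : ℕ) (lam : Fin n → ℝ),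
      (∀ s ⊆ b, s.Nonempty → dirichletKernel T (∑ i ∈ s, lam i) = 0) →
      ‖∫ ω, ∏ i ∈ b, dft X T (lam i) ω ∂P‖ ≤ C := by
  induction k with
  | zero =>
    refine ⟨P.real Set.univ, fun b hb T lam _ => ?_⟩
    simp [Finset.card_eq_zero.1 (Nat.le_zero.1 hb), abs_of_nonneg measureReal_nonneg]
  | succ k ih =>
    obtain ⟨C, hC⟩ := ih (hX.mono k.le_succ) fun m hm => hA m (hm.trans k.lt_succ_self)
    obtain ⟨K, -, hK⟩ := exists_norm_integral_prod_dft_sub_le hX (hA k k.lt_succ_self) C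
    refine ⟨max C K, fun b hb T lam hlam => ?_⟩
    rcases hb.lt_or_eq with hlt | hcard
    · exact (hC b (Nat.lt_succ_iff.1 hlt) T lam hlam).trans (le_max_left _ _)
    let e := (b.orderEmbOfFin hcard).toEmbedding
    have hmap : Finset.univ.map e = b := Finset.map_orderEmbOfFin_univ b hcard
    have hkernel (s : Finset (Fin (k + 1))) (hs : s.Nonempty) :
        dirichletKernel T (∑ i ∈ s, lam (e i)) = 0 := by
      rw [← Finset.sum_map s e lam]
      exact hlam _ (hmap ▸ Finset.map_subset_map.2 (Finset.subset_univ s)) hs.map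
    have hbound := hK T (fun i => lam (e i)) fun b' _ hb' =>
      hC b' (Nat.lt_succ_iff.1 (by simpa using (Finset.card_lt_iff_ne_univ b').2 hb')) T _
        fun s _ => hkernel s
    rw [hkernel _ Finset.univ_nonempty, zero_mul, sub_zero] at hbound
    simp only [← hmap, Finset.prod_map]
    exact hbound.trans (le_max_right _ _)

lemma IsStationaryOfOrder.integrable_periodogram (hX : IsStationaryOfOrder P X (k + 1)) (T : ℕ)
    (lam : Fin k → ℝ) : Integrable (periodogram X T lam) P := by
  simp only [funext (periodogram_eq_prod X T lam)]
  exact (hX.integrable_prod_dft (by simp) T (balanced lam)).const_mul _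

lemma exists_norm_integral_periodogram_sub_le (hX : IsStationaryOfOrder P X (k + 1))
    (hA : ∀ m ≤ k, AssumptionA P X (m + 1)) :
    ∃ K : ℝ, 0 ≤ K ∧ ∀ T : ℕ, T ≠ 0 → ∀ lam : Fin k → ℝ,
      (∀ s : Finset (Fin k), s.Nonempty → dirichletKernel T (∑ j ∈ s, lam j) = 0) →
      ‖∫ ω, periodogram X T lam ω ∂P - polyspectrum P X k lam‖ ≤ K / T := by
  obtain ⟨C, hC⟩ := exists_norm_integral_prod_dft_le (hX.mono k.le_succ) fun m hm => hA m hm.le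
  obtain ⟨K, hK0, hK⟩ := exists_norm_integral_prod_dft_sub_le hX (hA k le_rfl) C
  refine ⟨K, hK0, fun T hT lam hlam => ?_⟩
  have hbound := hK T (balanced lam) fun b _ hb =>
    hC b (Nat.lt_succ_iff.1 (by simpa using (Finset.card_lt_iff_ne_univ b).2 hb)) T _
      fun s hsb hs => dirichletKernel_sum_balanced_eq_zero hlam hs
        fun hsu => hb (Finset.univ_subset_iff.1 (hsu ▸ hsb))
  rw [sum_balanced, dirichletKernel_zero, tail_balanced] at hbound
  have hfactor : ∫ ω, periodogram X T lam ω ∂P - polyspectrum P X k lam =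
      (T : ℂ)⁻¹ * (∫ ω, ∏ i, dft X T (balanced lam i) ω ∂P - T * polyspectrum P X k lam) := by
    simp only [periodogram_eq_prod]
    rw [integral_const_mul, mul_sub, inv_mul_cancel_left₀ (Nat.cast_ne_zero.2 hT)]
  rw [hfactor, norm_mul, norm_inv, Complex.norm_natCast, inv_mul_eq_div]
  gcongr

end Expectation

section Grid

variable {T k : ℕ}

lemma mem_fourierIndices {l : ℤ} : l ∈ fourierIndices T ↔ -(T : ℤ) < 2 * l ∧ 2 * l ≤ T := by
  simp only [fourierIndices, Finset.mem_filter, Finset.mem_Icc]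
  omega

lemma mem_fourierGrid {l : Fin k → ℤ} :
    l ∈ fourierGrid T k ↔ ∀ j, -(T : ℤ) < 2 * l j ∧ 2 * l j ≤ T := by
  simp only [fourierGrid, Fintype.mem_piFinset, mem_fourierIndices]

lemma eq_of_mem_fourierIndices_of_dvd_sub {a b : ℤ} (ha : a ∈ fourierIndices T)
    (hb : b ∈ fourierIndices T) (h : (T : ℤ) ∣ a - b) : a = b := by
  rw [mem_fourierIndices] at ha hb
  exact sub_eq_zero.1 (Int.eq_zero_of_abs_lt_dvd h (by rw [abs_lt]; omega))

lemma card_fourierIndices_le (T : ℕ) : (fourierIndices T).card ≤ T := by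
  have hsub : fourierIndices T ⊆ Finset.Ioc ((T / 2 : ℕ) - (T : ℤ)) (T / 2 : ℕ) := fun l hl => by
    rw [mem_fourierIndices] at hl
    rw [Finset.mem_Ioc]
    omega
  simpa using Finset.card_le_card hsub

lemma card_fourierGrid_le (T k : ℕ) : (fourierGrid T k).card ≤ T ^ k := by
  simpa [fourierGrid] using Nat.pow_le_pow_left (card_fourierIndices_le T) k

lemma injOn_restrict_fourierGrid_filter_dvd {s : Finset (Fin k)} {j : Fin k} (hj : j ∈ s) :
    Set.InjOn (fun (l : Fin k → ℤ) (i : {i // i ≠ j}) => l i)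
      ((fourierGrid T k).filter fun l => (T : ℤ) ∣ ∑ i ∈ s, l i) := by
  intro l hl l' hl' heq
  rw [Finset.mem_coe, Finset.mem_filter, fourierGrid, Fintype.mem_piFinset] at hl hl'
  have hne (i : Fin k) (hi : i ≠ j) : l i = l' i := congrFun heq ⟨i, hi⟩
  have hdvd := dvd_sub hl.2 hl'.2
  rw [← Finset.add_sum_erase s l hj, ← Finset.add_sum_erase s l' hj,
    Finset.sum_congr rfl fun i hi => hne i (Finset.ne_of_mem_erase hi),
    add_sub_add_right_eq_sub] at hdvd
  have hj_eq := eq_of_mem_fourierIndices_of_dvd_sub (hl.1 j) (hl'.1 j) hdvd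
  exact funext fun i => (eq_or_ne i j).elim (fun hi => hi ▸ hj_eq) (hne i)

lemma card_fourierGrid_filter_dvd_mul_le (T : ℕ) {s : Finset (Fin k)} (hs : s.Nonempty) :
    ((fourierGrid T k).filter fun l => (T : ℤ) ∣ ∑ i ∈ s, l i).card * T ≤ T ^ k := by
  obtain ⟨j, hj⟩ := hs
  have hcard : ((fourierGrid T k).filter fun l => (T : ℤ) ∣ ∑ i ∈ s, l i).card ≤
      (Fintype.piFinset fun _ : {i : Fin k // i ≠ j} => fourierIndices T).card :=
    Finset.card_le_card_of_injOn (fun l i => l i)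
      (fun l hl => Fintype.mem_piFinset.2 fun i =>
        Fintype.mem_piFinset.1 (Finset.mem_filter.1 hl).1 i)
      (injOn_restrict_fourierGrid_filter_dvd hj)
  have hpow : (Fintype.piFinset fun _ : {i : Fin k // i ≠ j} => fourierIndices T).card ≤
      T ^ (k - 1) := by
    simpa using Nat.pow_le_pow_left (card_fourierIndices_le T) (k - 1)
  rw [← pow_sub_one_mul j.pos.ne' T]
  exact Nat.mul_le_mul_right T (hcard.trans hpow)

lemma sum_fourierFreq (T : ℕ) (l : Fin k → ℤ) (s : Finset (Fin k)) :
    ∑ i ∈ s, fourierFreq T l i = 2 * Real.pi * ((∑ i ∈ s, l i : ℤ) : ℝ) / T := by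
  simp only [fourierFreq, Int.cast_sum, Finset.mul_sum, Finset.sum_div]

lemma offSubmanifolds_fourierFreq_iff (hT : T ≠ 0) (l : Fin k → ℤ) :
    OffSubmanifolds (fourierFreq T l) ↔
      ∀ s : Finset (Fin k), s.Nonempty → ¬ (T : ℤ) ∣ ∑ i ∈ s, l i := by
  refine forall₂_congr fun s _ => ?_
  rw [dvd_def, not_exists]
  refine forall_congr' fun m => not_congr ?_
  rw [sum_fourierFreq, div_eq_iff (Nat.cast_ne_zero.2 hT), mul_assoc (2 * Real.pi),
    mul_right_inj' Real.two_pi_pos.ne', mul_comm (m : ℝ)]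
  exact_mod_cast Iff.rfl

open Classical in
lemma card_fourierGrid_filter_not_offSubmanifolds_mul_le (hT : T ≠ 0) :
    ((fourierGrid T k).filter fun l => ¬ OffSubmanifolds (fourierFreq T l)).card * T ≤
      2 ^ k * T ^ k := by
  have hcover : ((fourierGrid T k).filter fun l => ¬ OffSubmanifolds (fourierFreq T l)) ⊆
      (Finset.univ.filter fun s : Finset (Fin k) => s.Nonempty).biUnion fun s =>
        (fourierGrid T k).filter fun l => (T : ℤ) ∣ ∑ i ∈ s, l i := fun l hl => by
    rw [Finset.mem_filter, offSubmanifolds_fourierFreq_iff hT] at hl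
    push Not at hl
    obtain ⟨hl, s, hs, hdvd⟩ := hl
    exact Finset.mem_biUnion.2
      ⟨s, Finset.mem_filter.2 ⟨Finset.mem_univ s, hs⟩, Finset.mem_filter.2 ⟨hl, hdvd⟩⟩
  refine (Nat.mul_le_mul_right T
    ((Finset.card_le_card hcover).trans Finset.card_biUnion_le)).trans ?_
  rw [Finset.sum_mul]
  refine (Finset.sum_le_card_nsmul _ _ (T ^ k) fun s hs =>
    card_fourierGrid_filter_dvd_mul_le T (Finset.mem_filter.1 hs).2).trans ?_
  rw [smul_eq_mul]
  exact Nat.mul_le_mul_right _ ((Finset.card_filter_le _ _).trans (by simp))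

lemma cubeIoc_subset_cube (k : ℕ) : cubeIoc k ⊆ cube k :=
  Set.pi_mono fun _ _ => Set.Ioc_subset_Icc_self

lemma zero_mem_cube (k : ℕ) : 0 ∈ cube k :=
  fun _ _ => ⟨neg_nonpos.2 Real.pi_pos.le, Real.pi_pos.le⟩

lemma fourierFreq_mem_cubeIoc (hT : T ≠ 0) {l : Fin k → ℤ} (hl : l ∈ fourierGrid T k) :
    fourierFreq T l ∈ cubeIoc k := by
  intro j _
  have hT0 : (0 : ℝ) < T := Nat.cast_pos.2 hT.bot_lt
  have hlower : -(T : ℝ) < 2 * (l j : ℝ) := mod_cast (mem_fourierGrid.1 hl j).1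
  have hupper : 2 * (l j : ℝ) ≤ T := mod_cast (mem_fourierGrid.1 hl j).2
  rw [fourierFreq, Set.mem_Ioc, lt_div_iff₀ hT0, div_le_iff₀ hT0]
  constructor <;> nlinarith [Real.pi_pos]

lemma fourierFreq_mem_cube (hT : T ≠ 0) {l : Fin k → ℤ} (hl : l ∈ fourierGrid T k) :
    fourierFreq T l ∈ cube k :=
  cubeIoc_subset_cube k (fourierFreq_mem_cubeIoc hT hl)

end Grid

section Discretization

variable {T k : ℕ}

/-- The index `l` of the grid cell of side `2π/T`, open below and closed above, that contains `w`;
it need not belong to `fourierGrid T k`. -/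
noncomputable def cellIndex (T : ℕ) (w : Fin k → ℝ) : Fin k → ℤ :=
  fun j => ⌈w j * T / (2 * Real.pi)⌉ - 1

/-- The grid cell `λ + (0, 2π/T]^k` with lower corner `λ = fourierFreq T l`. -/
def cell (T : ℕ) (l : Fin k → ℤ) : Set (Fin k → ℝ) :=
  Set.univ.pi fun j => Set.Ioc (fourierFreq T l j) (fourierFreq T l j + 2 * Real.pi / T)

/-- The Riemann sum of `h` over the Fourier frequencies in `(-π, π]^k`. -/
noncomputable def riemannSum (T : ℕ) (h : (Fin k → ℝ) → ℂ) : ℂ :=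
  (2 * (Real.pi : ℂ)) ^ k * ((T : ℂ) ^ k)⁻¹ * ∑ l ∈ fourierGrid T k, h (fourierFreq T l)

lemma mem_cell_iff (hT : T ≠ 0) {l : Fin k → ℤ} {w : Fin k → ℝ} :
    w ∈ cell T l ↔ l = cellIndex T w := by
  have hT0 : (0 : ℝ) < T := Nat.cast_pos.2 hT.bot_lt
  rw [cell, Set.mem_univ_pi, funext_iff]
  refine forall_congr' fun j => ?_
  rw [cellIndex, eq_sub_iff_add_eq, eq_comm (b := ⌈_⌉), Int.ceil_eq_iff, Set.mem_Ioc, fourierFreq,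
    ← add_div, div_lt_iff₀ hT0, le_div_iff₀ hT0, lt_div_iff₀ Real.two_pi_pos,
    div_le_iff₀ Real.two_pi_pos]
  push_cast
  constructor <;> rintro ⟨hlower, hupper⟩ <;> constructor <;> linarith

lemma mem_cell_cellIndex (hT : T ≠ 0) (w : Fin k → ℝ) : w ∈ cell T (cellIndex T w) :=
  (mem_cell_iff hT).2 rfl

lemma measurableSet_cell (T : ℕ) (l : Fin k → ℤ) : MeasurableSet (cell T l) :=
  MeasurableSet.univ_pi fun _ => measurableSet_Ioc

lemma volume_cell_ne_top (T : ℕ) (l : Fin k → ℤ) : volume (cell T l) ≠ ⊤ := by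
  rw [cell, Real.volume_pi_Ioc]
  exact ENNReal.prod_ne_top fun _ _ => ENNReal.ofReal_ne_top

lemma volume_real_cell (T : ℕ) (l : Fin k → ℤ) :
    volume.real (cell T l) = (2 * Real.pi / T) ^ k := by
  rw [measureReal_def, cell,
    Real.volume_pi_Ioc_toReal fun _ => le_add_of_nonneg_right (by positivity)]
  simp [div_pow]

lemma discretization_apply (hT : T ≠ 0) (g : (Fin k → ℝ) → ℂ) (w : Fin k → ℝ) :
    discretization g T w =
      if cellIndex T w ∈ fourierGrid T k then g (fourierFreq T (cellIndex T w)) else 0 := by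
  classical
  have hcell (l : Fin k → ℤ) : (cell T l).indicator (fun _ => g (fourierFreq T l)) w =
      if l = cellIndex T w then g (fourierFreq T l) else 0 := by
    rw [Set.indicator_apply]
    exact if_congr (mem_cell_iff hT) rfl rfl
  change ∑ l ∈ fourierGrid T k, (cell T l).indicator (fun _ => g (fourierFreq T l)) w = _
  simp only [hcell, Finset.sum_ite_eq']

lemma dist_fourierFreq_cellIndex_le (hT : T ≠ 0) (w : Fin k → ℝ) :
    dist w (fourierFreq T (cellIndex T w)) ≤ 2 * Real.pi / T := by
  refine (dist_pi_le_iff (by positivity)).2 fun j => ?_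
  obtain ⟨hlower, hupper⟩ := mem_cell_cellIndex hT w j (Set.mem_univ j)
  rw [Real.dist_eq, abs_of_pos (sub_pos.2 hlower)]
  exact sub_le_iff_le_add'.2 hupper

lemma norm_discretization_le (hT : T ≠ 0) {g : (Fin k → ℝ) → ℂ} {C : ℝ}
    (hC : ∀ lam ∈ cube k, ‖g lam‖ ≤ C) (w : Fin k → ℝ) : ‖discretization g T w‖ ≤ C := by
  rw [discretization_apply hT]
  split_ifs with h
  · exact hC _ (fourierFreq_mem_cube hT h)
  · exact norm_zero.trans_le ((norm_nonneg _).trans (hC 0 (zero_mem_cube k)))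

lemma integrable_indicator_cell (T : ℕ) (l : Fin k → ℤ) (c : ℂ) :
    Integrable ((cell T l).indicator fun _ => c) :=
  (integrable_indicator_iff (measurableSet_cell T l)).2
    (integrableOn_const (volume_cell_ne_top T l))

lemma integrable_discretization (g : (Fin k → ℝ) → ℂ) (T : ℕ) : Integrable (discretization g T) :=
  integrable_finsetSum _ fun l _ => integrable_indicator_cell T l _

lemma integral_discretization (g : (Fin k → ℝ) → ℂ) (T : ℕ) :
    ∫ w, discretization g T w = riemannSum T g := by
  change ∫ w, ∑ l ∈ fourierGrid T k, (cell T l).indicator (fun _ => g (fourierFreq T l)) w = _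
  rw [integral_finsetSum _ fun l _ => integrable_indicator_cell T l _, riemannSum, Finset.mul_sum]
  refine Finset.sum_congr rfl fun l _ => ?_
  rw [integral_indicator_const _ (measurableSet_cell T l), volume_real_cell, Complex.real_smul]
  push_cast
  rw [div_pow, div_eq_mul_inv]

lemma measurableSet_cubeIoc (k : ℕ) : MeasurableSet (cubeIoc k) :=
  MeasurableSet.univ_pi fun _ => measurableSet_Ioc

lemma volume_cubeIoc_lt_top (k : ℕ) : volume (cubeIoc k) < ⊤ := by
  rw [cubeIoc, Real.volume_pi_Ioc]
  exact ENNReal.prod_lt_top fun _ _ => ENNReal.ofReal_lt_top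

lemma volume_real_cubeIoc (k : ℕ) : volume.real (cubeIoc k) = (2 * Real.pi) ^ k := by
  rw [measureReal_def, cubeIoc,
    Real.volume_pi_Ioc_toReal fun _ => neg_le_self Real.pi_pos.le]
  simp [two_mul]

lemma cubeIoc_ae_eq_cube (k : ℕ) : cubeIoc k =ᵐ[volume] cube k := by
  rw [cubeIoc, cube, Set.pi_univ_Icc]
  exact Measure.univ_pi_Ioc_ae_eq_Icc

end Discretization

section RiemannSum

variable {T k : ℕ} {f g : (Fin k → ℝ) → ℂ} {C F : ℝ} {L : NNReal}

/-- The cube `(-π, π + 2π/T]^k` that contains all the cells of the Fourier grid. -/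
def extendedCube (T k : ℕ) : Set (Fin k → ℝ) :=
  Set.univ.pi fun _ => Set.Ioc (-Real.pi) (Real.pi + 2 * Real.pi / T)

lemma cubeIoc_subset_extendedCube (T k : ℕ) : cubeIoc k ⊆ extendedCube T k :=
  Set.pi_mono fun _ _ => Set.Ioc_subset_Ioc_right (le_add_of_nonneg_right (by positivity))

lemma volume_extendedCube_lt_top (T k : ℕ) : volume (extendedCube T k) < ⊤ := by
  rw [extendedCube, Real.volume_pi_Ioc]
  exact ENNReal.prod_lt_top fun _ _ => ENNReal.ofReal_lt_top

lemma volume_real_extendedCube (T k : ℕ) :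
    volume.real (extendedCube T k) = (2 * Real.pi * (1 + (T : ℝ)⁻¹)) ^ k := by
  have hle : -Real.pi ≤ Real.pi + 2 * Real.pi / T :=
    (neg_le_self Real.pi_pos.le).trans (le_add_of_nonneg_right (by positivity))
  rw [measureReal_def, extendedCube, Real.volume_pi_Ioc_toReal fun _ => hle, Finset.prod_const,
    Finset.card_univ, Fintype.card_fin]
  ring

lemma discretization_eq_zero_of_notMem_extendedCube (hT : T ≠ 0) (g : (Fin k → ℝ) → ℂ)
    {w : Fin k → ℝ} (hw : w ∉ extendedCube T k) : discretization g T w = 0 := by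
  rw [discretization_apply hT, if_neg fun hgrid => hw fun j hj => ?_]
  have hcorner := fourierFreq_mem_cubeIoc hT hgrid j hj
  have hcell := mem_cell_cellIndex hT w j hj
  exact ⟨hcorner.1.trans hcell.1, hcell.2.trans (by gcongr; exact hcorner.2)⟩

lemma one_add_pow_sub_one_le {x : ℝ} (hx0 : 0 ≤ x) (hx1 : x ≤ 1) (k : ℕ) :
    (1 + x) ^ k - 1 ≤ 2 ^ k * x := by
  have hconvex : ((1 - x) * 1 + x * 2) ^ k ≤ (1 - x) * 1 ^ k + x * 2 ^ k :=
    (convexOn_pow k).2 (Set.mem_Ici.2 zero_le_one) (Set.mem_Ici.2 zero_le_two)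
      (sub_nonneg.2 hx1) hx0 (sub_add_cancel 1 x)
  rw [show (1 - x) * 1 + x * 2 = 1 + x by ring, one_pow] at hconvex
  linarith

lemma volume_real_extendedCube_sdiff_le (hT : T ≠ 0) (k : ℕ) :
    volume.real (extendedCube T k \ cubeIoc k) ≤ (4 * Real.pi) ^ k / T := by
  have hTinv : (T : ℝ)⁻¹ ≤ 1 := inv_le_one_of_one_le₀ (Nat.one_le_cast.2 hT.bot_lt)
  rw [measureReal_sdiff (cubeIoc_subset_extendedCube T k) (measurableSet_cubeIoc k)
    (volume_extendedCube_lt_top T k).ne, volume_real_extendedCube, volume_real_cubeIoc]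
  calc (2 * Real.pi * (1 + (T : ℝ)⁻¹)) ^ k - (2 * Real.pi) ^ k
      = (2 * Real.pi) ^ k * ((1 + (T : ℝ)⁻¹) ^ k - 1) := by rw [mul_pow, mul_sub_one]
    _ ≤ (2 * Real.pi) ^ k * (2 ^ k * (T : ℝ)⁻¹) := by
        gcongr
        exact one_add_pow_sub_one_le (by positivity) hTinv k
    _ = (4 * Real.pi) ^ k / T := by
        rw [← mul_assoc, ← mul_pow, div_eq_mul_inv]
        ring_nf

lemma norm_riemannSum_sub_setIntegral_discretization_le (hT : T ≠ 0)
    (hC : ∀ lam ∈ cube k, ‖g lam‖ ≤ C) :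
    ‖riemannSum T g - ∫ w in cubeIoc k, discretization g T w‖ ≤ C * ((4 * Real.pi) ^ k / T) := by
  have hC0 : 0 ≤ C := (norm_nonneg _).trans (hC 0 (zero_mem_cube k))
  rw [← integral_discretization,
    ← integral_add_compl (measurableSet_cubeIoc k) (integrable_discretization g T),
    add_sub_cancel_left,
    setIntegral_eq_of_subset_of_forall_sdiff_eq_zero (s := extendedCube T k \ cubeIoc k)
      (measurableSet_cubeIoc k).compl (fun _ hw => hw.2) fun w hw =>
        discretization_eq_zero_of_notMem_extendedCube hT g fun hmem => hw.2 ⟨hmem, hw.1⟩]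
  refine (norm_setIntegral_le_of_norm_le_const
    ((measure_mono Set.sdiff_subset).trans_lt (volume_extendedCube_lt_top T k))
    fun w _ => norm_discretization_le hT hC w).trans ?_
  exact mul_le_mul_of_nonneg_left (volume_real_extendedCube_sdiff_le hT k) hC0

lemma norm_mul_sub_discretization_le (hT : T ≠ 0) (hF : ∀ lam, ‖f lam‖ ≤ F)
    (hL : LipschitzWith L f) (hC : ∀ lam ∈ cube k, ‖g lam‖ ≤ C) (w : Fin k → ℝ) :
    ‖f w * g w - discretization (fun lam => f lam * g lam) T w‖ ≤
      F * ‖g w - discretization g T w‖ + L * (2 * Real.pi / T) * C := by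
  have hC0 : 0 ≤ C := (norm_nonneg _).trans (hC 0 (zero_mem_cube k))
  rw [discretization_apply hT, discretization_apply hT]
  split_ifs with hgrid
  · set c := fourierFreq T (cellIndex T w)
    have hf : ‖f w - f c‖ ≤ L * (2 * Real.pi / T) :=
      (hL.norm_sub_le w c).trans (by
        gcongr
        rw [← dist_eq_norm]
        exact dist_fourierFreq_cellIndex_le hT w)
    calc ‖f w * g w - f c * g c‖
        = ‖f w * (g w - g c) + (f w - f c) * g c‖ := by ring_nf
      _ ≤ ‖f w‖ * ‖g w - g c‖ + ‖f w - f c‖ * ‖g c‖ := by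
          rw [← norm_mul, ← norm_mul]
          exact norm_add_le _ _
      _ ≤ F * ‖g w - g c‖ + L * (2 * Real.pi / T) * C := by
          gcongr
          exacts [hF w, hC c (fourierFreq_mem_cube hT hgrid)]
  · rw [sub_zero, sub_zero, norm_mul]
    refine le_add_of_le_of_nonneg ?_ (by positivity)
    gcongr
    exact hF w

lemma norm_setIntegral_mul_sub_discretization_le (hT : T ≠ 0) (hF : ∀ lam, ‖f lam‖ ≤ F)
    (hL : LipschitzWith L f) (hC : ∀ lam ∈ cube k, ‖g lam‖ ≤ C)
    (hg : IntegrableOn g (cubeIoc k)) :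
    ‖∫ w in cubeIoc k, (f w * g w - discretization (fun lam => f lam * g lam) T w)‖ ≤
      F * (∫ w in cubeIoc k, ‖g w - discretization g T w‖) +
        L * (2 * Real.pi / T) * C * (2 * Real.pi) ^ k := by
  have hdiff : IntegrableOn (fun w => F * ‖g w - discretization g T w‖) (cubeIoc k) :=
    (hg.sub (integrable_discretization g T).integrableOn).norm.const_mul F
  have hconst : IntegrableOn (fun _ => L * (2 * Real.pi / T) * C) (cubeIoc k) :=
    integrableOn_const (volume_cubeIoc_lt_top k).ne
  refine (norm_integral_le_of_norm_le (hdiff.add hconst)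
    (.of_forall (norm_mul_sub_discretization_le hT hF hL hC))).trans_eq ?_
  simp only [Pi.add_apply]
  rw [integral_add hdiff hconst, integral_const_mul, setIntegral_const, volume_real_cubeIoc,
    smul_eq_mul, mul_comm (_ ^ k)]

lemma exists_norm_riemannSum_mul_sub_setIntegral_le (hF : ∀ lam, ‖f lam‖ ≤ F)
    (hL : LipschitzWith L f) (hC : ∀ lam ∈ cube k, ‖g lam‖ ≤ C) (hg : IntegrableOn g (cube k)) :
    ∃ D : ℝ, ∀ T : ℕ, T ≠ 0 →
      ‖riemannSum T (fun lam => f lam * g lam) - ∫ lam in cube k, f lam * g lam‖ ≤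
        F * (∫ w in cubeIoc k, ‖g w - discretization g T w‖) + D / T := by
  have hg' : IntegrableOn g (cubeIoc k) := hg.mono_set (cubeIoc_subset_cube k)
  have hfg : IntegrableOn (fun lam => f lam * g lam) (cubeIoc k) :=
    hg'.bdd_mul hL.continuous.aestronglyMeasurable (.of_forall hF)
  have hFC (lam) (hlam : lam ∈ cube k) : ‖f lam * g lam‖ ≤ F * C := by
    rw [norm_mul]
    exact mul_le_mul (hF lam) (hC lam hlam) (norm_nonneg _) ((norm_nonneg _).trans (hF lam))
  refine ⟨L * (2 * Real.pi) * C * (2 * Real.pi) ^ k + F * C * (4 * Real.pi) ^ k, fun T hT => ?_⟩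
  have hoverhang := norm_riemannSum_sub_setIntegral_discretization_le hT hFC
  have hinner := norm_setIntegral_mul_sub_discretization_le hT hF hL hC hg'
  rw [integral_sub hfg (integrable_discretization _ T).integrableOn, norm_sub_rev] at hinner
  rw [← setIntegral_congr_set (cubeIoc_ae_eq_cube k)]
  refine (norm_sub_le_norm_sub_add_norm_sub _ _ _).trans
    ((add_le_add hoverhang hinner).trans_eq ?_)
  ring

end RiemannSum

section Convergence

variable {k : ℕ} {g : (Fin k → ℝ) → ℂ} {C : ℝ} {w : Fin k → ℝ}

lemma eventually_cellIndex_mem_fourierGrid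
    (hw : w ∈ Set.univ.pi fun _ => Set.Ioo (-Real.pi) Real.pi) :
    ∀ᶠ T : ℕ in atTop, cellIndex T w ∈ fourierGrid T k := by
  have hlarge : ∀ᶠ T : ℕ in atTop, ∀ j, 2 * Real.pi < (w j + Real.pi) * T :=
    eventually_all.2 fun j => (tendsto_natCast_atTop_atTop.const_mul_atTop
      (neg_lt_iff_pos_add.1 (hw j (Set.mem_univ j)).1)).eventually_gt_atTop _
  filter_upwards [hlarge, eventually_ne_atTop 0] with T hTw hT
  have hT0 : (0 : ℝ) < T := Nat.cast_pos.2 hT.bot_lt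
  refine mem_fourierGrid.2 fun j => ?_
  have hupper : w j * T < Real.pi * T := mul_lt_mul_of_pos_right (hw j (Set.mem_univ j)).2 hT0
  have hcell := mem_cell_cellIndex hT w j (Set.mem_univ j)
  rw [Set.mem_Ioc, fourierFreq, ← add_div, div_lt_iff₀ hT0, le_div_iff₀ hT0] at hcell
  have hl : -(T : ℝ) < 2 * (cellIndex T w j : ℝ) :=
    lt_of_mul_lt_mul_left (by linarith [hTw j]) Real.pi_pos.le
  have hu : 2 * (cellIndex T w j : ℝ) ≤ T :=
    le_of_mul_le_mul_left (by linarith) Real.pi_pos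
  exact ⟨mod_cast hl, mod_cast hu⟩

lemma tendsto_fourierFreq_cellIndex (hw : w ∈ Set.univ.pi fun _ => Set.Ioo (-Real.pi) Real.pi) :
    Tendsto (fun T : ℕ => fourierFreq T (cellIndex T w)) atTop (nhdsWithin w (cube k)) := by
  refine tendsto_nhdsWithin_iff.2 ⟨?_, ?_⟩
  · refine tendsto_iff_dist_tendsto_zero.2 (squeeze_zero' (.of_forall fun _ => dist_nonneg) ?_
      (tendsto_const_div_atTop_nhds_zero_nat (2 * Real.pi)))
    filter_upwards [eventually_ne_atTop 0] with T hT
    rw [dist_comm]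
    exact dist_fourierFreq_cellIndex_le hT w
  · filter_upwards [eventually_cellIndex_mem_fourierGrid hw, eventually_ne_atTop 0] with T hgrid hT
    exact fourierFreq_mem_cube hT hgrid

lemma tendsto_discretization (hw : w ∈ Set.univ.pi fun _ => Set.Ioo (-Real.pi) Real.pi)
    (hg : ContinuousWithinAt g (cube k) w) :
    Tendsto (fun T : ℕ => discretization g T w) atTop (nhds (g w)) := by
  refine (hg.tendsto.comp (tendsto_fourierFreq_cellIndex hw)).congr' ?_
  filter_upwards [eventually_cellIndex_mem_fourierGrid hw, eventually_ne_atTop 0] with T hgrid hT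
  rw [discretization_apply hT, if_pos hgrid, Function.comp_apply]

lemma tendsto_integral_norm_sub_discretization (hC : ∀ lam ∈ cube k, ‖g lam‖ ≤ C)
    (hg : IntegrableOn g (cube k))
    (hg_cont : ∀ᵐ lam ∂(volume.restrict (cube k)), ContinuousWithinAt g (cube k) lam) :
    Tendsto (fun T : ℕ => ∫ w in cubeIoc k, ‖g w - discretization g T w‖) atTop (nhds 0) := by
  have hopen : (Set.univ.pi fun _ => Set.Ioo (-Real.pi) Real.pi) =ᵐ[volume] cube k := by
    rw [cube, Set.pi_univ_Icc]
    exact Measure.univ_pi_Ioo_ae_eq_Icc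
  have hinterior : ∀ᵐ w ∂(volume.restrict (cube k)),
      w ∈ Set.univ.pi fun _ => Set.Ioo (-Real.pi) Real.pi := by
    rw [← Measure.restrict_congr_set hopen]
    exact ae_restrict_mem (MeasurableSet.univ_pi fun _ => measurableSet_Ioo)
  rw [← integral_zero (Fin k → ℝ) ℝ (μ := volume.restrict (cubeIoc k))]
  refine tendsto_integral_filter_of_dominated_convergence (fun _ => C + C) ?_ ?_
    (integrableOn_const (volume_cubeIoc_lt_top k).ne) ?_
  · exact .of_forall fun T => ((hg.mono_set (cubeIoc_subset_cube k)).sub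
      (integrable_discretization g T).integrableOn).norm.aestronglyMeasurable
  · filter_upwards [eventually_ne_atTop 0] with T hT
    filter_upwards [ae_restrict_mem (measurableSet_cubeIoc k)] with w hw
    rw [norm_norm]
    exact norm_sub_le_of_le (hC w (cubeIoc_subset_cube k hw)) (norm_discretization_le hT hC w)
  · rw [Measure.restrict_congr_set (cubeIoc_ae_eq_cube k)]
    filter_upwards [hinterior, hg_cont] with w hw hgw
    simpa using (tendsto_const_nhds (x := g w)).sub (tendsto_discretization hw hgw) |>.norm

end Convergence

section Estimator

variable {Ω : Type*} [MeasurableSpace Ω] {P : Measure Ω} [IsFiniteMeasure P] {X : ℤ → Ω → ℝ}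
  {T k : ℕ} {g h : (Fin k → ℝ) → ℂ} {C c : ℝ}

lemma norm_riemannSum_le_card_mul {s : Finset (Fin k → ℤ)} (hs : s ⊆ fourierGrid T k)
    (hh : ∀ l ∈ s, ‖h (fourierFreq T l)‖ ≤ c)
    (h_zero : ∀ l ∈ fourierGrid T k, l ∉ s → h (fourierFreq T l) = 0) :
    ‖riemannSum T h‖ ≤ (2 * Real.pi) ^ k * ((T : ℝ) ^ k)⁻¹ * (s.card * c) := by
  have hprefactor : ‖(2 * (Real.pi : ℂ)) ^ k * ((T : ℂ) ^ k)⁻¹‖ =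
      (2 * Real.pi) ^ k * ((T : ℝ) ^ k)⁻¹ := by
    simp [abs_of_pos Real.pi_pos]
  rw [riemannSum, ← Finset.sum_subset hs h_zero, norm_mul, hprefactor]
  gcongr
  exact (norm_sum_le_of_le s hh).trans_eq (by rw [Finset.sum_const, nsmul_eq_mul])

lemma norm_riemannSum_le (hT : T ≠ 0) (hc : 0 ≤ c)
    (hh : ∀ l ∈ fourierGrid T k, ‖h (fourierFreq T l)‖ ≤ c) :
    ‖riemannSum T h‖ ≤ (2 * Real.pi) ^ k * c := by
  have hTk : (0 : ℝ) < (T : ℝ) ^ k := pow_pos (Nat.cast_pos.2 hT.bot_lt) k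
  have hcard : ((fourierGrid T k).card : ℝ) ≤ (T : ℝ) ^ k := mod_cast card_fourierGrid_le T k
  calc ‖riemannSum T h‖
      ≤ (2 * Real.pi) ^ k * ((T : ℝ) ^ k)⁻¹ * ((fourierGrid T k).card * c) :=
        norm_riemannSum_le_card_mul Finset.Subset.rfl hh fun _ hl hl' => absurd hl hl'
    _ ≤ (2 * Real.pi) ^ k * ((T : ℝ) ^ k)⁻¹ * ((T : ℝ) ^ k * c) := by gcongr
    _ = (2 * Real.pi) ^ k * c := by rw [mul_assoc, inv_mul_cancel_left₀ hTk.ne']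

lemma norm_riemannSum_le_div (hT : T ≠ 0) (hc : 0 ≤ c)
    (hh : ∀ l ∈ fourierGrid T k, ‖h (fourierFreq T l)‖ ≤ c)
    (h_zero : ∀ lam, OffSubmanifolds lam → h lam = 0) :
    ‖riemannSum T h‖ ≤ (4 * Real.pi) ^ k * c / T := by
  classical
  have hT0 : (0 : ℝ) < T := Nat.cast_pos.2 hT.bot_lt
  set s := (fourierGrid T k).filter fun l => ¬ OffSubmanifolds (fourierFreq T l)
  have hcard : (s.card : ℝ) * T ≤ 2 ^ k * (T : ℝ) ^ k :=
    mod_cast card_fourierGrid_filter_not_offSubmanifolds_mul_le hT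
  calc ‖riemannSum T h‖
      ≤ (2 * Real.pi) ^ k * ((T : ℝ) ^ k)⁻¹ * (s.card * c) :=
        norm_riemannSum_le_card_mul (Finset.filter_subset _ _)
          (fun l hl => hh l (Finset.mem_filter.1 hl).1) fun l hl hls =>
            h_zero _ (not_not.1 fun hoff => hls (Finset.mem_filter.2 ⟨hl, hoff⟩))
    _ ≤ (2 * Real.pi) ^ k * ((T : ℝ) ^ k)⁻¹ * (2 ^ k * (T : ℝ) ^ k / T * c) := by
        gcongr
        exact (le_div_iff₀ hT0).2 hcard
    _ = (4 * Real.pi) ^ k * c / T := by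
        rw [show 4 * Real.pi = 2 * Real.pi * 2 by ring, mul_pow _ (2 : ℝ)]
        field_simp

lemma riemannSum_add (T : ℕ) (h₁ h₂ : (Fin k → ℝ) → ℂ) :
    riemannSum T (fun lam => h₁ lam + h₂ lam) = riemannSum T h₁ + riemannSum T h₂ := by
  simp only [riemannSum, Finset.sum_add_distrib, mul_add]

lemma integral_polyMeanEstimator (hX : IsStationaryOfOrder P X (k + 1)) (g : (Fin k → ℝ) → ℂ)
    (T : ℕ) :
    ∫ ω, polyMeanEstimator X g T ω ∂P =
      riemannSum T fun lam => (∫ ω, periodogram X T lam ω ∂P) * g lam * Phi lam := by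
  simp only [polyMeanEstimator, riemannSum]
  rw [integral_const_mul, integral_finsetSum _ fun l _ =>
    ((hX.integrable_periodogram T _).mul_const _).mul_const _]
  simp only [integral_mul_const]

lemma exists_norm_riemannSum_bias_le (hX : IsStationaryOfOrder P X (k + 1))
    (hA : ∀ m ≤ k, AssumptionA P X (m + 1)) (hC : ∀ lam ∈ cube k, ‖g lam‖ ≤ C) :
    ∃ K : ℝ, ∀ T : ℕ, T ≠ 0 →
      ‖riemannSum T fun lam =>
        (∫ ω, periodogram X T lam ω ∂P - polyspectrum P X k lam) * g lam * Phi lam‖ ≤ K / T := by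
  have hC0 : 0 ≤ C := (norm_nonneg _).trans (hC 0 (zero_mem_cube k))
  obtain ⟨K, hK0, hK⟩ := exists_norm_integral_periodogram_sub_le hX hA
  refine ⟨(2 * Real.pi) ^ k * (K * C), fun T hT =>
    (norm_riemannSum_le (c := K / T * C) hT (by positivity) fun l hl => ?_).trans_eq (by ring)⟩
  by_cases hoff : OffSubmanifolds (fourierFreq T l)
  · rw [Phi, if_pos hoff, mul_one, norm_mul]
    exact mul_le_mul (hK T hT _ fun _ => hoff.dirichletKernel_sum_eq_zero)
      (hC _ (fourierFreq_mem_cube hT hl)) (norm_nonneg _) (by positivity)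
  · rw [Phi, if_neg hoff, mul_zero, norm_zero]
    positivity

lemma norm_riemannSum_mul_Phi_sub_one_le (hT : T ≠ 0) (hC : ∀ lam ∈ cube k, ‖h lam‖ ≤ C) :
    ‖riemannSum T fun lam => h lam * (Phi lam - 1)‖ ≤ (4 * Real.pi) ^ k * C / T := by
  have hPhi (lam : Fin k → ℝ) : ‖Phi lam - 1‖ ≤ 1 := by
    unfold Phi
    split_ifs <;> simp
  refine norm_riemannSum_le_div hT ((norm_nonneg _).trans (hC 0 (zero_mem_cube k)))
    (fun l hl => ?_) fun lam hoff => by rw [Phi, if_pos hoff, sub_self, mul_zero]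
  rw [norm_mul]
  exact (mul_le_of_le_one_right (norm_nonneg _) (hPhi _)).trans (hC _ (fourierFreq_mem_cube hT hl))

lemma exists_norm_integral_polyMeanEstimator_sub_riemannSum_le
    (hX : IsStationaryOfOrder P X (k + 1)) (hA : ∀ m ≤ k, AssumptionA P X (m + 1))
    (hC : ∀ lam ∈ cube k, ‖g lam‖ ≤ C) :
    ∃ K : ℝ, ∀ T : ℕ, T ≠ 0 →
      ‖∫ ω, polyMeanEstimator X g T ω ∂P -
        riemannSum T fun lam => polyspectrum P X k lam * g lam‖ ≤ K / T := by
  obtain ⟨K, hK⟩ := exists_norm_riemannSum_bias_le hX hA hC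
  have hfg (lam : Fin k → ℝ) (hlam : lam ∈ cube k) :
      ‖polyspectrum P X k lam * g lam‖ ≤ autocumulantMass P X k * C := by
    rw [norm_mul]
    have hf := (hA k le_rfl).norm_polyspectrum_le lam
    exact mul_le_mul hf (hC lam hlam) (norm_nonneg _) ((norm_nonneg _).trans hf)
  refine ⟨K + (4 * Real.pi) ^ k * (autocumulantMass P X k * C), fun T hT => ?_⟩
  have hsplit : ∫ ω, polyMeanEstimator X g T ω ∂P =
      (riemannSum T fun lam => polyspectrum P X k lam * g lam) +
      ((riemannSum T fun lam =>
        (∫ ω, periodogram X T lam ω ∂P - polyspectrum P X k lam) * g lam * Phi lam) +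
      riemannSum T fun lam => polyspectrum P X k lam * g lam * (Phi lam - 1)) := by
    rw [integral_polyMeanEstimator hX, ← riemannSum_add, ← riemannSum_add]
    congr 1 with lam
    ring
  rw [hsplit, add_sub_cancel_left, add_div]
  exact norm_add_le_of_le (hK T hT) (norm_riemannSum_mul_Phi_sub_one_le hT hfg)

lemma exists_norm_integral_polyMeanEstimator_sub_polyMean_le
    (hX : IsStationaryOfOrder P X (k + 1)) (hA : ∀ m ≤ k, AssumptionA P X (m + 1))
    (hC : ∀ lam ∈ cube k, ‖g lam‖ ≤ C) (hg : IntegrableOn g (cube k)) :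
    ∃ F K : ℝ, ∀ T : ℕ, T ≠ 0 →
      ‖∫ ω, polyMeanEstimator X g T ω ∂P - polyMean P X g‖ ≤
        F * (∫ w in cubeIoc k, ‖g w - discretization g T w‖) + K / T := by
  have hA_top := hA k le_rfl
  obtain ⟨K, hK⟩ := exists_norm_integral_polyMeanEstimator_sub_riemannSum_le hX hA hC
  obtain ⟨D, hD⟩ := exists_norm_riemannSum_mul_sub_setIntegral_le hA_top.norm_polyspectrum_le
    hA_top.lipschitzWith_polyspectrum hC hg
  refine ⟨autocumulantMass P X k, K + D, fun T hT => ?_⟩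
  exact (norm_sub_le_norm_sub_add_norm_sub _ _ _).trans
    ((add_le_add (hK T hT) (hD T hT)).trans_eq (by ring))

end Estimator

end Polyspectral

theorem proposition1_general {Ω : Type*} [MeasurableSpace Ω] (P : Measure Ω) [IsFiniteMeasure P]
    (X : ℤ → Ω → ℝ) (k : ℕ) (hX : Polyspectral.IsStationaryOfOrder P X (k + 1))
    (hA : ∀ m ≤ k, Polyspectral.AssumptionA P X (m + 1)) (g : (Fin k → ℝ) → ℂ)
    (hg_int : IntegrableOn g (Polyspectral.cube k))
    (hg_bdd : ∃ C : ℝ, ∀ lam ∈ Polyspectral.cube k, ‖g lam‖ ≤ C) :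
    ((∀ᵐ lam ∂(volume.restrict (Polyspectral.cube k)),
        ContinuousWithinAt g (Polyspectral.cube k) lam) →
      (fun T : ℕ => (∫ ω, Polyspectral.polyMeanEstimator X g T ω ∂P) -
        Polyspectral.polyMean P X g) =o[atTop] (fun _ : ℕ => (1 : ℝ))) ∧
    ((fun T : ℕ => ∫ w in Polyspectral.cubeIoc k, ‖g w - Polyspectral.discretization g T w‖)
        =O[atTop] (fun T : ℕ => (T : ℝ)⁻¹) →
      (fun T : ℕ => (∫ ω, Polyspectral.polyMeanEstimator X g T ω ∂P) -
        Polyspectral.polyMean P X g) =O[atTop] (fun T : ℕ => (T : ℝ)⁻¹)) := by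
  obtain ⟨C, hC⟩ := hg_bdd
  obtain ⟨F, K, hFK⟩ :=
    Polyspectral.exists_norm_integral_polyMeanEstimator_sub_polyMean_le hX hA hC hg_int
  have hbound := (eventually_ne_atTop 0).mono hFK
  simp only [div_eq_mul_inv] at hbound
  refine ⟨fun hg_cont => ?_, fun hO => ?_⟩
  · rw [isLittleO_one_iff]
    refine squeeze_zero_norm' hbound ?_
    simpa using ((Polyspectral.tendsto_integral_norm_sub_discretization hC hg_int
      hg_cont).const_mul F).add (tendsto_inv_atTop_nhds_zero_nat.const_mul K)
  · exact (IsBigO.of_bound' (hbound.mono fun T hT => hT.trans (le_abs_self _))).trans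
      ((hO.const_mul_left F).add ((isBigO_refl _ _).const_mul_left K))

theorem proposition1 {Ω : Type*} [MeasurableSpace Ω] (P : MeasureTheory.Measure Ω)
    [MeasureTheory.IsProbabilityMeasure P] (X : ℤ → Ω → ℝ) (k : ℕ) (hk : 1 ≤ k)
    (hX : Polyspectral.IsStationaryOfOrder P X (k + 1))
    (hmean : ∀ t, ∫ ω, X t ω ∂P = 0)
    (hA : ∀ r, 2 ≤ r → r ≤ k + 1 → Polyspectral.AssumptionA P X r)
    (g : (Fin k → ℝ) → ℂ)
    (hg_symm : ∀ lam ∈ Polyspectral.cube k, g lam = (starRingEnd ℂ) (g (-lam)))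
    (hg_int : MeasureTheory.IntegrableOn g (Polyspectral.cube k))
    (hg_bdd : ∃ C : ℝ, ∀ lam ∈ Polyspectral.cube k, ‖g lam‖ ≤ C)
    (hg_cont : ∀ᵐ lam ∂(MeasureTheory.volume.restrict (Polyspectral.cube k)),
      ContinuousWithinAt g (Polyspectral.cube k) lam) :
    ((fun T : ℕ => (∫ ω, Polyspectral.polyMeanEstimator X g T ω ∂P) -
        Polyspectral.polyMean P X g) =o[Filter.atTop] (fun _ : ℕ => (1 : ℝ))) ∧
    (((fun T : ℕ => ∫ w in Polyspectral.cubeIoc k,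
          ‖g w - Polyspectral.discretization g T w‖) =O[Filter.atTop]
            (fun T : ℕ => (T : ℝ)⁻¹)) →
      ((fun T : ℕ => (∫ ω, Polyspectral.polyMeanEstimator X g T ω ∂P) -
        Polyspectral.polyMean P X g) =O[Filter.atTop] (fun T : ℕ => (T : ℝ)⁻¹))) := by
  exact (proposition1_general P X k hX (fun m hm j => hA (m + 1) (Nat.succ_le_succ j.pos)
    (Nat.succ_le_succ hm) j) g hg_int hg_bdd).imp_left fun ho => ho hg_cont
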